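/- Let $F:\mathbb R^n\rightrightarrows\mathbb R^n$ be a multifunction such that (F1) $F(x)$ is nonempty, compact and convex for every $x$; (F2) for every compact $K\subset\mathbb R^n$ there is a constant $L$ with $F(x)\subset F(y)+L\|y-x\|\bar B$ for all $x,y\in K$, where $\bar B$ is the closed unit ball; (F3) there are constants $\gamma,c>0$ such that $\|v\|\le\gamma\|x\|+c$ for all $x\in\mathbb R^n$ and $v\in F(x)$. For $\alpha,\beta\in\mathbb R^n$ let $T(\alpha,\beta)\in[0,+\infty]$ be the infimum of all $t\ge 0$ for which there is an absolutely continuous $x:[0,t]\to\mathbb R^n$ with $\dot x(s)\in F(x(s))$ for a.e. $s\in[0,t]$, $x(0)=\alpha$ and $x(t)=\beta$ (with $\inf\emptyset=+\infty$). Put $\mathcal R(t)=\{(x,y)\in\mathbb R^n\times\mathbb R^n: T(x,y)\le t\}$, $\mathcal R=\bigcup_{t\ge0}\mathcal R(t)$, $\mathrm{epi}(T)=\{((x,y),s)\in(\mathbb R^n\times\mathbb R^n)\times\mathbb R: T(x,y)\le s\}$ and $h(x,p)=\min_{v\in F(x)}\langle v,p\rangle$. For a subset $S$ of a Euclidean space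 and $x\in S$, let $\widehat N_S(x)$ be the set of Fréchet normals to $S$ at $x$, i.e. of all vectors $\zeta$ such that for every $\varepsilon>0$ there is $\delta>0$ with $\langle\zeta,y-x\rangle\le\varepsilon\|y-x\|$ for all $y\in S$ with $\|y-x\|<\delta$. Let $(\alpha,\beta)\in\mathcal R$ be such that $r:=T(\alpha,\beta)>0$. Then: (i) For all $\zeta,\theta\in\mathbb R^n$, if $(\zeta,\theta)\in\widehat N_{\mathcal R(r)}(\alpha,\beta)$, then $h(\alpha,\zeta)=h(\beta,-\theta)$ and $((\zeta,\theta),h(\alpha,\zeta))\in\widehat N_{\mathrm{epi}(T)}((\alpha,\beta),r)$. (ii) For all $\zeta,\theta\in\mathbb R^n$ and $\lambda\in\mathbb R$, if $((\zeta,\theta),\lambda)\in\widehat N_{\mathrm{epi}(T)}((\alpha,\beta),r)$, then $\lambda\le0$, $h(\alpha,\zeta)=h(\beta,-\theta)=\lambda$ and $(\zeta,\theta)\in\widehat N_{\mathcal R(r)}(\alpha,\beta)$. In particular, for all $\zeta,\theta\in\mathbb R^n$, one has $(\zeta,\theta)\in\widehat N_{\mathcal R(r)}(\alpha,\beta)$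 if and only if $h(\alpha,\zeta)=h(\beta,-\theta)$ and $((\zeta,\theta),h(\alpha,\zeta))\in\widehat N_{\mathrm{epi}(T)}((\alpha,\beta),r)$. -/

import Mathlib

open scoped RealInnerProductSpace

/-- `ℝⁿ` with its Euclidean norm and inner product. -/
abbrev EucSpace (n : ℕ) : Type := EuclideanSpace ℝ (Fin n)

/-- `ℝⁿ × ℝⁿ` with the Euclidean norm `‖(x, y)‖² = ‖x‖² + ‖y‖²` and the inner product
`⟪(ζ, θ), (x, y)⟫ = ⟪ζ, x⟫ + ⟪θ, y⟫`. -/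
abbrev PairSpace (n : ℕ) : Type := WithLp 2 (EucSpace n × EucSpace n)

/-- `(ℝⁿ × ℝⁿ) × ℝ` with its Euclidean norm and inner product. -/
abbrev EpiSpace (n : ℕ) : Type := WithLp 2 (PairSpace n × ℝ)

/-- The point `(x, y)` of `ℝⁿ × ℝⁿ`. -/
def mkPair {n : ℕ} (x y : EucSpace n) : PairSpace n := WithLp.toLp 2 (x, y)

/-- The point `((x, y), s)` of `(ℝⁿ × ℝⁿ) × ℝ`. -/
def mkEpi {n : ℕ} (p : PairSpace n) (s : ℝ) : EpiSpace n := WithLp.toLp 2 (p, s)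

/-- The Fréchet normal cone to `S` at `x`: all `ζ` with
`limsup_{S ∋ y → x} ⟪ζ, y - x⟫ / ‖y - x‖ ≤ 0`, written out with `ε` and `δ`. -/
def frechetNormalCone {H : Type*} [NormedAddCommGroup H] [InnerProductSpace ℝ H]
    (S : Set H) (x : H) : Set H :=
  {ζ | ∀ ε : ℝ, 0 < ε → ∃ δ : ℝ, 0 < δ ∧
    ∀ y ∈ S, ‖y - x‖ < δ → ⟪ζ, y - x⟫ ≤ ε * ‖y - x‖}

/-- The epigraph of an extended real-valued function on `ℝⁿ × ℝⁿ`. Since the second coordinate is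
a real number, a point of the epigraph lies above the effective domain. -/
def epigraph {n : ℕ} (f : PairSpace n → EReal) : Set (EpiSpace n) :=
  {q | f q.fst ≤ (q.snd : EReal)}

/-- The assumptions on the multifunction `F : ℝⁿ ⇉ ℝⁿ`: nonempty compact convex values, local
Lipschitz continuity, and linear growth. -/
structure IsAdmissible {n : ℕ} (F : EucSpace n → Set (EucSpace n)) : Prop where
  nonempty : ∀ x, (F x).Nonempty
  compact : ∀ x, IsCompact (F x)
  convex : ∀ x, Convex ℝ (F x)
  /-- On each compact set `K` there is `L` with `F x ⊆ F y + L ‖y - x‖ B̄` for `x, y ∈ K`. -/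
  locallyLipschitz : ∀ K : Set (EucSpace n), IsCompact K → ∃ L : ℝ, 0 ≤ L ∧
    ∀ x ∈ K, ∀ y ∈ K, ∀ v ∈ F x, ∃ w ∈ F y, ‖v - w‖ ≤ L * ‖y - x‖
  linearGrowth : ∃ γ c : ℝ, 0 < γ ∧ 0 < c ∧ ∀ x, ∀ v ∈ F x, ‖v‖ ≤ γ * ‖x‖ + c

/-- `x` is (on `[0, τ]`) a trajectory of `F`: it is absolutely continuous on `[0, τ]` and
`x'(t) ∈ F (x(t))` for almost every `t ∈ [0, τ]`. -/
structure IsTrajectory {n : ℕ} (F : EucSpace n → Set (EucSpace n)) (τ : ℝ)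
    (x : ℝ → EucSpace n) : Prop where
  absolutelyContinuous : AbsolutelyContinuousOnInterval x 0 τ
  inclusion : ∀ᵐ t : ℝ, t ∈ Set.Icc 0 τ → DifferentiableAt ℝ x t ∧ deriv x t ∈ F (x t)

/-- The bilateral minimal time function: the infimum, in the extended reals, of the times `t ≥ 0`
at which some trajectory of `F` starting at `α` is at `β`. It is `+∞` if there is none. -/
noncomputable def minTime {n : ℕ} (F : EucSpace n → Set (EucSpace n)) (α β : EucSpace n) : EReal :=
  sInf {s : EReal | ∃ t : ℝ, 0 ≤ t ∧ s = (t : EReal) ∧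
    ∃ x : ℝ → EucSpace n, IsTrajectory F t x ∧ x 0 = α ∧ x t = β}

/-- The bilateral minimal time function as a function on `ℝⁿ × ℝⁿ`. -/
noncomputable def minTimeFun {n : ℕ} (F : EucSpace n → Set (EucSpace n)) (p : PairSpace n) :
    EReal :=
  minTime F p.fst p.snd

/-- The reachable set at time `t`, that is the sub-level set `{(α, β) | T(α, β) ≤ t}`. -/
def reachableSetAt {n : ℕ} (F : EucSpace n → Set (EucSpace n)) (t : ℝ) : Set (PairSpace n) :=
  {p | minTimeFun F p ≤ (t : EReal)}

/-- The reachable set, the union over `t ≥ 0` of the reachable sets at time `t`. -/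
def reachableSet {n : ℕ} (F : EucSpace n → Set (EucSpace n)) : Set (PairSpace n) :=
  ⋃ t : ℝ, ⋃ _ : 0 ≤ t, reachableSetAt F t

/-- The Hamiltonian `h(x, p) = min_{v ∈ F(x)} ⟪v, p⟫`; the infimum is a minimum when `F x` is
nonempty and compact. -/
noncomputable def hamiltonian {n : ℕ} (F : EucSpace n → Set (EucSpace n)) (x p : EucSpace n) : ℝ :=
  sInf ((fun v => ⟪v, p⟫) '' F x)

/-!
The points of the level set `{T ≤ r}` and of the epigraph of `T` near `(α, β)` are related by
small changes of the time available to a trajectory. Two first-order facts measure these changes.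

* A trajectory leaving a point near `α` for a short time `d` has displacement at least
  `d * h(α, p) - o(d)` in direction `p` (`IsAdmissible.exists_displacement_bound`), because its
  velocities stay close to `F α` by the Lipschitz condition.
* Points near `α` can be joined to, for any short time `d`, by a trajectory whose displacement in
  direction `p` is at most `d * h(α, p) + o(d)` (`IsAdmissible.exists_reach_displacement`). Such a
  trajectory is produced by Filippov's successive approximation (`exists_reach_near_velocity`),
  in which nearest-point projections onto the convex values of `F` keep all velocities
  continuous, so that no measurable selection is needed.

If `((ζ, θ), l)` is normal to the epigraph, dropping an initial piece of a nearly optimal trajectory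
yields `h(α, ζ) ≤ l`, and prolonging it backwards yields `l ≤ h(α, ζ)`. If `(ζ, θ)` is normal to the
level set, dropping an initial piece while prolonging the end by the same time stays in the level
set and yields `h(α, ζ) ≤ h(β, -θ)`; time reversal, that is replacing `F` by `-F`, gives the
opposite inequality. Finally, a point `((x, y), s)` of the epigraph is moved into the level set by
shortening (`s > r`) or prolonging (`s < r`) at `x` by the time `|s - r|`, at the first-order cost
`h(α, ζ) * (s - r)`; hence normals to the level set lift to normals to the epigraph
(`IsLevelNormal.isEpiNormal`). Minimizing trajectories are never needed: trajectories that are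
optimal up to `d ^ 2` have the same first-order effect.
-/

open scoped Pointwise

/-! ### Absolute continuity under reparametrization -/

open AbsolutelyContinuousOnInterval in
/-- Precomposition with a monotone or antitone `1`-Lipschitz map preserves absolute continuity:
such a map does not lengthen intervals and keeps disjoint intervals non-overlapping. -/
theorem AbsolutelyContinuousOnInterval.comp_of_monotone_or_antitone {X : Type*} [PseudoMetricSpace X]
    {f : ℝ → X} {a b c d : ℝ} {φ : ℝ → ℝ} (hf : AbsolutelyContinuousOnInterval f c d)
    (hmaps : ∀ u ∈ Set.uIcc a b, φ u ∈ Set.uIcc c d)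
    (hdist : ∀ u v, dist (φ u) (φ v) ≤ dist u v)
    (hφ : Monotone φ ∨ Antitone φ) :
    AbsolutelyContinuousOnInterval (f ∘ φ) a b := by
  rw [absolutelyContinuousOnInterval_iff] at hf ⊢
  intro ε hε
  obtain ⟨δ, hδ, H⟩ := hf ε hε
  refine ⟨δ, hδ, fun E hE hlt => ?_⟩
  refine H (E.1, fun i => (φ (E.2 i).1, φ (E.2 i).2)) ⟨?_, ?_⟩ ?_
  · exact fun i hi => ⟨hmaps _ (hE.1 i hi).1, hmaps _ (hE.1 i hi).2⟩
  · intro i hi j hj hij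
    have h := hE.2 hi hj hij
    simp only [Function.onFun, Set.uIoc, Set.Ioc_disjoint_Ioc] at h ⊢
    rcases hφ with hφ | hφ
    · simpa only [← hφ.map_max, ← hφ.map_min] using hφ h
    · simpa only [← hφ.map_max, ← hφ.map_min] using hφ h
  · exact (Finset.sum_le_sum fun i _ => hdist _ _).trans_lt hlt

theorem AbsolutelyContinuousOnInterval.comp_const_sub {X : Type*} [PseudoMetricSpace X]
    {f : ℝ → X} {τ : ℝ} (hf : AbsolutelyContinuousOnInterval f 0 τ) :
    AbsolutelyContinuousOnInterval (fun t => f (τ - t)) 0 τ := by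
  refine hf.comp_of_monotone_or_antitone (φ := fun t => τ - t) ?_ ?_ ?_
  · intro u hu
    rw [Set.mem_uIcc] at hu ⊢
    grind
  · intro u v
    rw [dist_sub_left]
  · exact Or.inr fun u v h => sub_le_sub_left h τ

theorem AbsolutelyContinuousOnInterval.comp_add_const {X : Type*} [PseudoMetricSpace X]
    {f : ℝ → X} {s a b : ℝ} (hf : AbsolutelyContinuousOnInterval f (a + s) (b + s)) :
    AbsolutelyContinuousOnInterval (fun t => f (t + s)) a b := by
  refine hf.comp_of_monotone_or_antitone (φ := fun t => t + s) ?_ ?_ ?_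
  · intro u hu
    rw [Set.mem_uIcc] at hu ⊢
    grind
  · intro u v
    rw [dist_add_right]
  · exact Or.inl fun u v h => add_le_add_left h s

theorem AbsolutelyContinuousOnInterval.comp_min {X : Type*} [PseudoMetricSpace X]
    {f : ℝ → X} {s b : ℝ} (hs : 0 ≤ s) (hb : s ≤ b)
    (hf : AbsolutelyContinuousOnInterval f 0 s) :
    AbsolutelyContinuousOnInterval (fun t => f (min t s)) 0 b := by
  refine hf.comp_of_monotone_or_antitone (φ := fun t => min t s) ?_ ?_ ?_
  · intro u hu
    rw [Set.mem_uIcc] at hu ⊢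
    grind
  · intro u v
    simp only [Real.dist_eq]
    grind
  · exact Or.inl fun u v h => min_le_min_right s h

theorem AbsolutelyContinuousOnInterval.comp_max_sub {X : Type*} [PseudoMetricSpace X]
    {f : ℝ → X} {s t : ℝ} (hs : 0 ≤ s)
    (hf : AbsolutelyContinuousOnInterval f 0 t) :
    AbsolutelyContinuousOnInterval (fun u => f (max (u - s) 0)) 0 (s + t) := by
  refine hf.comp_of_monotone_or_antitone (φ := fun u => max (u - s) 0) ?_ ?_ ?_
  · intro u hu
    rw [Set.mem_uIcc] at hu ⊢
    grind
  · intro u v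
    simp only [Real.dist_eq]
    grind
  · exact Or.inl fun u v h => max_le_max_right 0 (sub_le_sub_right h s)

theorem AbsolutelyContinuousOnInterval.inner_left {E : Type*} [NormedAddCommGroup E]
    [InnerProductSpace ℝ E] {f : ℝ → E} {a b : ℝ} (hf : AbsolutelyContinuousOnInterval f a b)
    (p : E) : AbsolutelyContinuousOnInterval (fun t => ⟪p, f t⟫) a b := by
  refine squeeze_zero (fun _ => Finset.sum_nonneg fun _ _ => dist_nonneg) (fun E => ?_)
    (by simpa using Filter.Tendsto.const_mul ‖p‖ hf)
  rw [Finset.mul_sum]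
  refine Finset.sum_le_sum fun i _ => ?_
  rw [Real.dist_eq, ← inner_sub_right, dist_eq_norm]
  exact abs_real_inner_le_norm _ _

/-! ### Reachability in a given time -/

/-- `y` is reached from `x` by a trajectory of `F` in time exactly `t`. -/
def Reach {n : ℕ} (F : EucSpace n → Set (EucSpace n)) (t : ℝ) (x y : EucSpace n) : Prop :=
  0 ≤ t ∧ ∃ z : ℝ → EucSpace n, IsTrajectory F t z ∧ z 0 = x ∧ z t = y

section Reach

variable {n : ℕ} {F : EucSpace n → Set (EucSpace n)} {s t : ℝ} {x y z : EucSpace n}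

theorem Reach.minTime_le (h : Reach F t x y) : minTime F x y ≤ (t : EReal) :=
  sInf_le ⟨t, h.1, rfl, h.2⟩

theorem exists_reach_of_minTime_lt (h : minTime F x y < (s : EReal)) :
    ∃ t < s, Reach F t x y := by
  obtain ⟨_, ⟨t, ht, rfl, hz⟩, hlt⟩ := sInf_lt_iff.1 h
  exact ⟨t, EReal.coe_lt_coe_iff.1 hlt, ht, hz⟩

theorem minTime_le_coe_iff :
    minTime F x y ≤ (s : EReal) ↔ ∀ η : ℝ, 0 < η → ∃ t < s + η, Reach F t x y := by
  refine ⟨fun h η hη => exists_reach_of_minTime_lt (h.trans_lt ?_), fun h => ?_⟩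
  · exact EReal.coe_lt_coe_iff.2 (by linarith)
  · refine EReal.le_of_forall_lt_iff_le.1 fun c hc => ?_
    obtain ⟨t, ht, hR⟩ := h (c - s) (by linarith [EReal.coe_lt_coe_iff.1 hc])
    exact hR.minTime_le.trans (EReal.coe_le_coe_iff.2 (by linarith))

theorem Reach.split (h : Reach F t x y) (hs : 0 ≤ s) (hst : s ≤ t) :
    ∃ z, Reach F s x z ∧ Reach F (t - s) z y := by
  obtain ⟨_, w, ⟨hac, hin⟩, rfl, rfl⟩ := h
  refine ⟨w s, ⟨hs, w, ⟨?_, ?_⟩, rfl, rfl⟩, ⟨by linarith, fun u => w (u + s), ⟨?_, ?_⟩, ?_, ?_⟩⟩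
  · refine hac.mono ?_
    rw [Set.uIcc_of_le hs, Set.uIcc_of_le (hs.trans hst)]
    exact Set.Icc_subset_Icc_right hst
  · filter_upwards [hin] with u hu hmem
    exact hu ⟨hmem.1, hmem.2.trans hst⟩
  · refine AbsolutelyContinuousOnInterval.comp_add_const (hac.mono ?_)
    rw [Set.uIcc_of_le (by linarith), Set.uIcc_of_le (by linarith)]
    exact Set.Icc_subset_Icc (by linarith) (by linarith)
  · filter_upwards [(MeasureTheory.quasiMeasurePreserving_add_right
      (MeasureTheory.volume : MeasureTheory.Measure ℝ) s).ae hin] with u hu hmem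
    obtain ⟨hd, hF⟩ := hu ⟨by linarith [hmem.1], by linarith [hmem.2]⟩
    refine ⟨differentiableAt_comp_add_const.2 hd, ?_⟩
    rwa [deriv_comp_add_const]
  · simp
  · simp

theorem Reach.trans (h₁ : Reach F s x y) (h₂ : Reach F t y z) : Reach F (s + t) x z := by
  obtain ⟨hs, u, ⟨hac, hin⟩, rfl, rfl⟩ := h₁
  obtain ⟨ht, v, ⟨hac', hin'⟩, hv, rfl⟩ := h₂
  -- Writing the concatenation as a sum reduces its absolute continuity to that of the summands.
  refine ⟨by linarith, fun r => u (min r s) + v (max (r - s) 0) - u s, ⟨?_, ?_⟩, ?_, ?_⟩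
  · exact ((hac.comp_min hs (by linarith)).fun_add (hac'.comp_max_sub hs)).fun_sub
      (LipschitzOnWith.absolutelyContinuousOnInterval
        ((LipschitzWith.const (u s)).lipschitzOnWith))
  · have hne : ∀ᵐ r : ℝ, r ≠ s := by simp [MeasureTheory.ae_iff, MeasureTheory.measure_singleton]
    have hin'' := (MeasureTheory.measurePreserving_sub_right
      (MeasureTheory.volume : MeasureTheory.Measure ℝ) s).quasiMeasurePreserving.ae hin'
    filter_upwards [hin, hin'', hne] with r hr hr' hrs hmem
    rcases lt_or_gt_of_ne hrs with h | h
    · obtain ⟨hd, hF⟩ := hr ⟨hmem.1, h.le⟩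
      have heq : (fun r => u (min r s) + v (max (r - s) 0) - u s) =ᶠ[nhds r] u := by
        filter_upwards [eventually_lt_nhds h] with q hq
        rw [min_eq_left hq.le, max_eq_right (by linarith), hv, add_sub_cancel_right]
      refine ⟨heq.differentiableAt_iff.2 hd, ?_⟩
      rw [heq.deriv_eq, heq.eq_of_nhds]
      exact hF
    · obtain ⟨hd, hF⟩ := hr' ⟨by linarith, by linarith [hmem.2]⟩
      have heq : (fun r => u (min r s) + v (max (r - s) 0) - u s) =ᶠ[nhds r]
          fun r => v (r - s) := by
        filter_upwards [eventually_gt_nhds h] with q hq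
        rw [min_eq_right hq.le, max_eq_left (by linarith), add_sub_cancel_left]
      refine ⟨heq.differentiableAt_iff.2 (differentiableAt_comp_sub_const.2 hd), ?_⟩
      rw [heq.deriv_eq, heq.eq_of_nhds, deriv_comp_sub_const]
      exact hF
  · simp [hs, hv]
  · simp [ht]

theorem Reach.reverse (h : Reach F t x y) : Reach (fun x => -F x) t y x := by
  obtain ⟨ht, w, ⟨hac, hin⟩, rfl, rfl⟩ := h
  refine ⟨ht, fun u => w (t - u), ⟨hac.comp_const_sub, ?_⟩, by simp, by simp⟩
  filter_upwards [(MeasureTheory.quasiMeasurePreserving_sub_left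
    (MeasureTheory.volume : MeasureTheory.Measure ℝ) t).ae hin] with u hu hmem
  obtain ⟨hd, hF⟩ := hu ⟨by linarith [hmem.2], by linarith [hmem.1]⟩
  refine ⟨differentiableAt_comp_const_sub.2 hd, ?_⟩
  rw [deriv_comp_const_sub]
  simpa using hF

theorem reach_neg_iff : Reach (fun x => -F x) t y x ↔ Reach F t x y :=
  ⟨fun h => by simpa using h.reverse, Reach.reverse⟩

theorem minTime_neg : minTime (fun x => -F x) y x = minTime F x y := by
  have : ∀ t, Reach (fun x => -F x) t y x ↔ Reach F t x y := fun t => reach_neg_iff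
  unfold minTime
  congr 1
  ext q
  exact exists_congr fun t => ⟨fun ⟨h0, hq, h⟩ => ⟨h0, hq, ((this t).1 ⟨h0, h⟩).2⟩,
    fun ⟨h0, hq, h⟩ => ⟨h0, hq, ((this t).2 ⟨h0, h⟩).2⟩⟩

theorem minTime_le_add (h₁ : minTime F x y ≤ (s : EReal)) (h₂ : minTime F y z ≤ (t : EReal)) :
    minTime F x z ≤ ((s + t : ℝ) : EReal) := by
  rw [minTime_le_coe_iff] at *
  intro η hη
  obtain ⟨a, ha, hR⟩ := h₁ (η / 2) (by linarith)
  obtain ⟨b, hb, hR'⟩ := h₂ (η / 2) (by linarith)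
  exact ⟨a + b, by linarith, hR.trans hR'⟩

end Reach

section Admissible

variable {n : ℕ} {F : EucSpace n → Set (EucSpace n)}

theorem IsAdmissible.neg (hF : IsAdmissible F) : IsAdmissible (fun x => -F x) where
  nonempty x := (hF.nonempty x).neg
  compact x := (hF.compact x).neg
  convex x := (hF.convex x).neg
  locallyLipschitz K hK := by
    obtain ⟨L, hL, H⟩ := hF.locallyLipschitz K hK
    refine ⟨L, hL, fun x hx y hy v hv => ?_⟩
    obtain ⟨w, hw, hvw⟩ := H x hx y hy (-v) hv
    refine ⟨-w, by simpa using hw, ?_⟩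
    rwa [sub_neg_eq_add, ← norm_neg, neg_add, ← sub_eq_add_neg]
  linearGrowth := by
    obtain ⟨γ, c, hγ, hc, H⟩ := hF.linearGrowth
    exact ⟨γ, c, hγ, hc, fun x v hv => by simpa using H x (-v) hv⟩

theorem hamiltonian_neg (x p : EucSpace n) :
    hamiltonian (fun x => -F x) x p = hamiltonian F x (-p) := by
  unfold hamiltonian
  congr 1
  ext q
  constructor
  · rintro ⟨v, hv, rfl⟩
    exact ⟨-v, hv, by simp⟩
  · rintro ⟨v, hv, rfl⟩
    exact ⟨-v, by simpa using hv, by simp⟩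

theorem IsAdmissible.exists_inner_eq_hamiltonian (hF : IsAdmissible F) (x p : EucSpace n) :
    ∃ v ∈ F x, ⟪v, p⟫ = hamiltonian F x p := by
  have hc : IsCompact ((fun v => ⟪v, p⟫) '' F x) :=
    (hF.compact x).image (by fun_prop)
  exact hc.sInf_mem ((hF.nonempty x).image _)

theorem IsAdmissible.hamiltonian_le (hF : IsAdmissible F) {x v : EucSpace n} (hv : v ∈ F x)
    (p : EucSpace n) : hamiltonian F x p ≤ ⟪v, p⟫ := by
  have hc : IsCompact ((fun v => ⟪v, p⟫) '' F x) :=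
    (hF.compact x).image (by fun_prop)
  exact csInf_le hc.bddBelow ⟨v, hv, rfl⟩

end Admissible

/-! ### Displacement along trajectories -/

section Displacement

variable {n : ℕ} {F : EucSpace n → Set (EucSpace n)}

theorem IsTrajectory.inner_sub_le {d t c : ℝ} {w : ℝ → EucSpace n} (h : IsTrajectory F d w)
    (ht : t ∈ Set.Icc 0 d) (p : EucSpace n)
    (H : ∀ s ∈ Set.Icc 0 t, ∀ v ∈ F (w s), ⟪p, v⟫ ≤ c) : ⟪p, w t - w 0⟫ ≤ t * c := by
  have hsub : Set.uIcc 0 t ⊆ Set.uIcc 0 d := by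
    rw [Set.uIcc_of_le ht.1, Set.uIcc_of_le (ht.1.trans ht.2)]
    exact Set.Icc_subset_Icc_right ht.2
  have hac : AbsolutelyContinuousOnInterval (fun s => ⟪p, w s⟫) 0 t :=
    (h.absolutelyContinuous.mono hsub).inner_left p
  have hint := intervalIntegral.integral_mono_ae_restrict ht.1 hac.intervalIntegrable_deriv
    (intervalIntegrable_const (c := c)) <| by
      refine (MeasureTheory.ae_restrict_iff' measurableSet_Icc).2 ?_
      filter_upwards [h.inclusion] with s hs hmem
      obtain ⟨hd, hv⟩ := hs ⟨hmem.1, hmem.2.trans ht.2⟩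
      have hderiv : HasDerivAt (fun s => ⟪p, w s⟫) ⟪p, deriv w s⟫ s := by
        simpa using (hasDerivAt_const s p).inner ℝ hd.hasDerivAt
      rw [hderiv.deriv]
      exact H s hmem _ hv
  rw [hac.integral_deriv_eq_sub, intervalIntegral.integral_const, smul_eq_mul, sub_zero] at hint
  rwa [inner_sub_right]

theorem IsTrajectory.le_inner_sub {d t c : ℝ} {w : ℝ → EucSpace n} (h : IsTrajectory F d w)
    (ht : t ∈ Set.Icc 0 d) (p : EucSpace n)
    (H : ∀ s ∈ Set.Icc 0 t, ∀ v ∈ F (w s), c ≤ ⟪p, v⟫) : t * c ≤ ⟪p, w t - w 0⟫ := by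
  have := h.inner_sub_le ht (-p) (c := -c) fun s hs v hv => by
    rw [inner_neg_left]; exact neg_le_neg (H s hs v hv)
  rw [inner_neg_left] at this
  linarith

/-- Trajectories starting near `α` move at bounded speed for a short time. The linear growth bound
at the point of largest displacement suffices, so Grönwall's inequality is not needed. -/
theorem IsAdmissible.exists_norm_trajectory_sub_le (hF : IsAdmissible F) (α : EucSpace n) :
    ∃ C δ : ℝ, 0 ≤ C ∧ 0 < δ ∧ δ ≤ 1 ∧ ∀ (d : ℝ) (w : ℝ → EucSpace n), IsTrajectory F d w →
      d < δ → ‖w 0 - α‖ < δ → ∀ t ∈ Set.Icc 0 d, ‖w t - w 0‖ ≤ C * t := by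
  obtain ⟨γ, c, hγ, hc, hgr⟩ := hF.linearGrowth
  refine ⟨2 * (γ * (‖α‖ + 1) + c), min 1 (1 / (2 * γ)), by positivity, by positivity,
    min_le_left _ _, fun d w hw hd h0 t ht => ?_⟩
  have hcont : ContinuousOn (fun s => ‖w s - w 0‖) (Set.Icc 0 t) := by
    have := hw.absolutelyContinuous.continuousOn
    rw [Set.uIcc_of_le (ht.1.trans ht.2)] at this
    exact ((this.mono (Set.Icc_subset_Icc_right ht.2)).sub continuousOn_const).norm
  obtain ⟨s, hs, hmax⟩ := isCompact_Icc.exists_isMaxOn ⟨0, Set.left_mem_Icc.2 ht.1⟩ hcont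
  set m := ‖w s - w 0‖ with hm
  have hm0 : 0 ≤ m := norm_nonneg _
  have hw0 : ‖w 0‖ ≤ ‖α‖ + 1 := by
    have h1 := norm_le_norm_add_norm_sub' (w 0) α
    have h2 := h0.le.trans (min_le_left _ _)
    linarith
  have htγ : t * γ ≤ 1 / 2 := by
    have : t ≤ 1 / (2 * γ) := (ht.2.trans hd.le).trans (min_le_right _ _)
    calc t * γ ≤ 1 / (2 * γ) * γ := by gcongr
      _ = 1 / 2 := by field_simp
  have key : m * m ≤ s * (m * (γ * (‖α‖ + 1 + m) + c)) := by
    have := hw.inner_sub_le ⟨hs.1, hs.2.trans ht.2⟩ (w s - w 0)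
      (c := m * (γ * (‖α‖ + 1 + m) + c)) fun u hu v hv => by
        refine (real_inner_le_norm _ _).trans ?_
        refine mul_le_mul_of_nonneg_left ((hgr _ _ hv).trans ?_) hm0
        have h3 : ‖w u - w 0‖ ≤ m := hmax ⟨hu.1, hu.2.trans hs.2⟩
        have h4 := norm_le_norm_add_norm_sub' (w u) (w 0)
        gcongr
        linarith
    rwa [real_inner_self_eq_norm_mul_norm] at this
  have hmt : ‖w t - w 0‖ ≤ m := hmax ⟨ht.1, le_rfl⟩
  refine hmt.trans ?_
  rcases hm0.eq_or_lt with h | h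
  · rw [← h]
    have := ht.1
    positivity
  · have hst : s * (m * (γ * (‖α‖ + 1 + m) + c)) ≤ t * (m * (γ * (‖α‖ + 1 + m) + c)) := by
      gcongr
      exact hs.2
    have h5 : m ≤ t * (γ * (‖α‖ + 1 + m) + c) := by
      refine le_of_mul_le_mul_left ?_ h
      linarith
    have h6 : t * γ * m ≤ 1 / 2 * m := by gcongr
    nlinarith

/-- Leaving a point near `α` along a trajectory for a short time `d`, the displacement in
direction `p` is at least `d * h(α, p)`, up to second order. -/
theorem IsAdmissible.exists_displacement_bound (hF : IsAdmissible F) (α : EucSpace n) :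
    ∃ C δ : ℝ, 0 ≤ C ∧ 0 < δ ∧ ∀ (d : ℝ) (x z : EucSpace n), Reach F d x z →
      d < δ → ‖x - α‖ < δ → ‖z - x‖ ≤ C * d ∧
      ∀ p, d * hamiltonian F α p - C * ‖p‖ * d * (‖x - α‖ + d) ≤ ⟪p, z - x⟫ := by
  obtain ⟨C, δ, hC, hδ, hδ1, H⟩ := hF.exists_norm_trajectory_sub_le α
  obtain ⟨L, hL, hLip⟩ := hF.locallyLipschitz (Metric.closedBall α (1 + C))
    (isCompact_closedBall _ _)
  refine ⟨C + L * (1 + C), δ, by positivity, hδ, ?_⟩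
  rintro d x z ⟨hd0, w, hw, rfl, rfl⟩ hd hx
  have hdisp := H d w hw hd hx
  refine ⟨(hdisp d ⟨hd0, le_rfl⟩).trans ?_, fun p => ?_⟩
  · gcongr
    exact le_add_of_nonneg_right (by positivity)
  · have := hw.le_inner_sub ⟨hd0, le_rfl⟩ p
      (c := hamiltonian F α p - ‖p‖ * (L * (‖w 0 - α‖ + C * d))) fun s hs v hv => by
        have h1 : ‖w s - α‖ ≤ ‖w 0 - α‖ + C * d := by
          have h2 := hdisp s hs
          have h3 : C * s ≤ C * d := by gcongr; exact hs.2
          have h4 := norm_add_le (w s - w 0) (w 0 - α)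
          rw [sub_add_sub_cancel] at h4
          linarith
        have hmem : w s ∈ Metric.closedBall α (1 + C) := by
          rw [mem_closedBall_iff_norm]
          have : C * d ≤ C * 1 := by gcongr; linarith
          linarith
        obtain ⟨u, hu, hvu⟩ := hLip _ hmem α (Metric.mem_closedBall_self (by positivity)) v hv
        have h5 := hF.hamiltonian_le hu p
        have h6 : ⟪p, u - v⟫ ≤ ‖p‖ * (L * (‖w 0 - α‖ + C * d)) := by
          refine (real_inner_le_norm _ _).trans ?_
          rw [norm_sub_rev]
          gcongr
          refine hvu.trans ?_
          rw [norm_sub_rev]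
          gcongr
        rw [inner_sub_right, real_inner_comm] at h6
        linarith
    refine le_trans ?_ this
    have h7 : L * (‖w 0 - α‖ + C * d) ≤ (C + L * (1 + C)) * (‖w 0 - α‖ + d) := by
      have := norm_nonneg (w 0 - α)
      have e : (C + L * (1 + C)) * (‖w 0 - α‖ + d) - L * (‖w 0 - α‖ + C * d) =
        C * (‖w 0 - α‖ + d) + L * C * ‖w 0 - α‖ + L * d := by ring
      have : 0 ≤ C * (‖w 0 - α‖ + d) + L * C * ‖w 0 - α‖ + L * d := by positivity
      linarith
    have h8 := mul_le_mul_of_nonneg_left h7 (mul_nonneg hd0 (norm_nonneg p))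
    linarith

end Displacement

/-! ### Stability of nearest points -/

section NearestPoint

variable {E : Type*} [NormedAddCommGroup E] [InnerProductSpace ℝ E]

theorem norm_sub_le_of_inner_le_zero {u v w : E} (h : ⟪u - v, w - v⟫ ≤ 0) :
    ‖u - v‖ ≤ ‖u - w‖ := by
  have h1 := norm_sub_sq_real (u - v) (w - v)
  rw [sub_sub_sub_cancel_right] at h1
  refine le_of_sq_le_sq ?_ (norm_nonneg _)
  nlinarith [sq_nonneg ‖w - v‖]

/-- Nearest points to `u` in `A` and to `u'` in `B`, characterized by the variational inequality,
differ by little if `u` is close to `u'` and `A` to `B` in the Hausdorff sense. -/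
theorem norm_nearest_sub_nearest_sq_le {u u' a b a' b' : E} {η : ℝ}
    (ha : ⟪u - a, a' - a⟫ ≤ 0) (hb : ⟪u' - b, b' - b⟫ ≤ 0)
    (hba : ‖b - a'‖ ≤ η) (hab : ‖a - b'‖ ≤ η) :
    ‖b - a‖ ^ 2 ≤ ‖b - a‖ * ‖u - u'‖ + η * (‖u - a‖ + ‖u' - b‖) := by
  have e : ‖b - a‖ ^ 2 = ⟪b - a, u' - u⟫ + ⟪u - a, b - a'⟫ + ⟪u' - b, a - b'⟫
      + ⟪u - a, a' - a⟫ + ⟪u' - b, b' - b⟫ := by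
    rw [← real_inner_self_eq_norm_sq]
    simp only [inner_sub_left, inner_sub_right]
    rw [real_inner_comm a b, real_inner_comm u' a, real_inner_comm u b, real_inner_comm u' b,
      real_inner_comm u a]
    ring
  have h1 := real_inner_le_norm (b - a) (u' - u)
  rw [norm_sub_rev u' u] at h1
  have h2 : ⟪u - a, b - a'⟫ ≤ ‖u - a‖ * η :=
    (real_inner_le_norm _ _).trans (mul_le_mul_of_nonneg_left hba (norm_nonneg _))
  have h3 : ⟪u' - b, a - b'⟫ ≤ ‖u' - b‖ * η :=
    (real_inner_le_norm _ _).trans (mul_le_mul_of_nonneg_left hab (norm_nonneg _))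
  linarith

theorem le_add_sqrt_of_sq_le {X a κ : ℝ} (hκ : 0 ≤ κ) (ha : 0 ≤ a)
    (h : X ^ 2 ≤ X * a + κ) : X ≤ a + √κ := by
  by_contra! hlt
  nlinarith [Real.sq_sqrt hκ, Real.sqrt_nonneg κ]

/-- The nearest point to `w t` in `F (x t)` depends continuously on `t`. -/
theorem continuous_nearest {F : E → Set E} {K : Set E} {L M : ℝ}
    (hLip : ∀ x ∈ K, ∀ y ∈ K, ∀ v ∈ F x, ∃ w ∈ F y, ‖v - w‖ ≤ L * ‖y - x‖) (hL : 0 ≤ L)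
    (hM : ∀ x ∈ K, ∀ v ∈ F x, ‖v‖ ≤ M) {x w g : ℝ → E} (hx : Continuous x) (hw : Continuous w)
    (hxK : ∀ t, x t ∈ K) (hwM : ∀ t, ‖w t‖ ≤ M) (hg : ∀ t, g t ∈ F (x t))
    (hgw : ∀ t, ∀ v ∈ F (x t), ⟪w t - g t, v - g t⟫ ≤ 0) : Continuous g := by
  have hM0 : 0 ≤ M := (norm_nonneg _).trans (hwM 0)
  have hb : ∀ t, ‖w t - g t‖ ≤ 2 * M := fun t => by
    have h1 := norm_sub_le (w t) (g t)
    have h2 := hwM t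
    have h3 := hM _ (hxK t) _ (hg t)
    linarith
  refine continuous_iff_continuousAt.2 fun t₀ => ?_
  rw [ContinuousAt, tendsto_iff_norm_sub_tendsto_zero]
  have hlim : Filter.Tendsto
      (fun t => ‖w t₀ - w t‖ + √(L * ‖x t - x t₀‖ * (4 * M))) (nhds t₀) (nhds 0) := by
    have : Continuous fun t => ‖w t₀ - w t‖ + √(L * ‖x t - x t₀‖ * (4 * M)) := by fun_prop
    simpa using this.tendsto t₀
  refine squeeze_zero (fun _ => norm_nonneg _) (fun t => ?_) hlim
  obtain ⟨b', hb', hab⟩ := hLip _ (hxK t₀) _ (hxK t) _ (hg t₀)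
  obtain ⟨a', ha', hba⟩ := hLip _ (hxK t) _ (hxK t₀) _ (hg t)
  rw [norm_sub_rev (x t₀)] at hba
  refine le_add_sqrt_of_sq_le (by positivity) (norm_nonneg _) ?_
  refine (norm_nearest_sub_nearest_sq_le (hgw t₀ a' ha') (hgw t b' hb') hba hab).trans ?_
  gcongr
  linarith [hb t, hb t₀]

end NearestPoint

/-! ### Existence of trajectories with prescribed initial velocity -/

section Filippov

variable {n : ℕ} {F : EucSpace n → Set (EucSpace n)}

/-- The primitive of `w` with value `y` at `0`, frozen outside `[0, d]`. The freezing makes bounds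
on `w` give bounds on the primitive that are uniform on the whole line. -/
noncomputable def frozenPrimitive (y : EucSpace n) (d : ℝ) (w : ℝ → EucSpace n) (t : ℝ) :
    EucSpace n :=
  y + ∫ s in (0 : ℝ)..max 0 (min t d), w s

theorem continuous_frozenPrimitive {y : EucSpace n} {d : ℝ} {w : ℝ → EucSpace n}
    (hw : Continuous w) : Continuous (frozenPrimitive y d w) := by
  have h : Continuous fun r : ℝ => ∫ s in (0 : ℝ)..r, w s :=
    intervalIntegral.continuous_primitive (fun a b => hw.intervalIntegrable a b) 0
  unfold frozenPrimitive
  exact continuous_const.add (h.comp (by fun_prop))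

theorem norm_frozenPrimitive_sub_le {y : EucSpace n} {d M : ℝ} {w : ℝ → EucSpace n} (hd : 0 ≤ d)
    (hM : ∀ t, ‖w t‖ ≤ M) (t : ℝ) : ‖frozenPrimitive y d w t - y‖ ≤ M * d := by
  have hM0 : 0 ≤ M := (norm_nonneg _).trans (hM 0)
  unfold frozenPrimitive
  rw [add_sub_cancel_left]
  refine (intervalIntegral.norm_integral_le_of_norm_le_const fun s _ => hM s).trans ?_
  gcongr
  rw [sub_zero, abs_of_nonneg (le_max_left _ _)]
  exact max_le hd (min_le_right _ _)

theorem norm_frozenPrimitive_sub_frozenPrimitive_le {y : EucSpace n} {d D : ℝ}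
    {w w' : ℝ → EucSpace n} (hd : 0 ≤ d) (hw : Continuous w) (hw' : Continuous w')
    (hD : ∀ t, ‖w t - w' t‖ ≤ D) (t : ℝ) :
    ‖frozenPrimitive y d w t - frozenPrimitive y d w' t‖ ≤ D * d := by
  have := norm_frozenPrimitive_sub_le (y := y) hd hD t
  unfold frozenPrimitive at *
  rwa [intervalIntegral.integral_sub (hw.intervalIntegrable _ _) (hw'.intervalIntegrable _ _),
    add_sub_cancel_left, ← add_sub_add_left_eq_sub _ _ y] at this

/-- Filippov's successive approximation. Each velocity is the nearest point of `F` along the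
previous approximate trajectory to the previous velocity. Convexity of the values makes these
velocities continuous in time, so the limit is a continuously differentiable trajectory. -/
theorem exists_reach_near_velocity {K : Set (EucSpace n)} {L M d : ℝ} {y β v : EucSpace n}
    (hne : ∀ x, (F x).Nonempty) (hcl : ∀ x, IsClosed (F x)) (hconv : ∀ x, Convex ℝ (F x))
    (hLip : ∀ x ∈ K, ∀ y ∈ K, ∀ v ∈ F x, ∃ w ∈ F y, ‖v - w‖ ≤ L * ‖y - x‖) (hL : 0 ≤ L)
    (hM : ∀ x ∈ K, ∀ v ∈ F x, ‖v‖ ≤ M) (hβ : β ∈ K) (hv : v ∈ F β) (hd : 0 ≤ d)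
    (hK : ∀ x, ‖x - y‖ ≤ M * d → x ∈ K) (hLd : L * d ≤ 1 / 2) :
    ∃ Y, Reach F d y Y ∧ ‖Y - y - d • v‖ ≤ 2 * (L * (‖y - β‖ + M * d)) * d := by
  have hM0 : 0 ≤ M := (norm_nonneg _).trans (hM β hβ v hv)
  have hnear : ∀ x u, ∃ p ∈ F x, ∀ q ∈ F x, ⟪u - p, q - p⟫ ≤ 0 := fun x u => by
    obtain ⟨p, hp, h⟩ :=
      exists_norm_eq_iInf_of_complete_convex (hne x) (hcl x).isComplete (hconv x) u
    exact ⟨p, hp, (norm_eq_iInf_iff_real_inner_le_zero (hconv x) hp).1 h⟩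
  choose P hPmem hP using hnear
  set X : (ℝ → EucSpace n) → ℝ → EucSpace n := frozenPrimitive y d with hX
  let W : ℕ → ℝ → EucSpace n := fun k =>
    Nat.rec (fun _ => v) (fun _ w t => P (X w t) (w t)) k
  have hW0 : ∀ t, W 0 t = v := fun _ => rfl
  have hWs : ∀ k t, W (k + 1) t = P (X (W k) t) (W k t) := fun _ _ => rfl
  have hWM : ∀ k t, ‖W k t‖ ≤ M := by
    intro k
    induction k with
    | zero => exact fun t => hM β hβ v hv
    | succ k ih =>
      exact fun t => hM _ (hK _ (norm_frozenPrimitive_sub_le hd ih t)) _ (hPmem _ _)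
  have hXK : ∀ k t, X (W k) t ∈ K := fun k t => hK _ (norm_frozenPrimitive_sub_le hd (hWM k) t)
  have hWc : ∀ k, Continuous (W k) := by
    intro k
    induction k with
    | zero => exact continuous_const
    | succ k ih =>
      exact continuous_nearest hLip hL hM (continuous_frozenPrimitive ih) ih (hXK k) (hWM k)
        (fun t => hPmem _ _) (fun t q hq => hP _ _ q hq)
  set D := L * (‖y - β‖ + M * d) with hD
  have hstep : ∀ k t, ‖W k t - W (k + 1) t‖ ≤ D / 2 ^ k := by
    intro k
    induction k with
    | zero =>
      intro t
      obtain ⟨u, hu, hvu⟩ := hLip β hβ _ (hXK 0 t) v hv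
      rw [pow_zero, div_one]
      refine (norm_sub_le_of_inner_le_zero (hP _ _ u hu)).trans (hvu.trans ?_)
      rw [hD]
      gcongr
      have h1 := norm_add_le (X (W 0) t - y) (y - β)
      rw [sub_add_sub_cancel] at h1
      have h2 : ‖X (W 0) t - y‖ ≤ M * d := norm_frozenPrimitive_sub_le hd (hWM 0) t
      linarith
    | succ k ih =>
      intro t
      obtain ⟨u, hu, hvu⟩ := hLip _ (hXK k t) _ (hXK (k + 1) t) (W (k + 1) t) (hPmem _ _)
      refine (norm_sub_le_of_inner_le_zero (hP _ _ u hu)).trans (hvu.trans ?_)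
      have h1 : ‖X (W (k + 1)) t - X (W k) t‖ ≤ D / 2 ^ k * d := by
        rw [norm_sub_rev]
        exact norm_frozenPrimitive_sub_frozenPrimitive_le hd (hWc k) (hWc (k + 1)) ih t
      have h2 : 0 ≤ D / 2 ^ k := (norm_nonneg _).trans (ih t)
      calc L * ‖X (W (k + 1)) t - X (W k) t‖ ≤ L * (D / 2 ^ k * d) := by gcongr
        _ = L * d * (D / 2 ^ k) := by ring
        _ ≤ 1 / 2 * (D / 2 ^ k) := by gcongr
        _ = D / 2 ^ (k + 1) := by rw [pow_succ]; field_simp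
  have hdist : ∀ t k, dist (W k t) (W (k + 1) t) ≤ 2 * D / 2 / 2 ^ k := fun t k => by
    rw [dist_eq_norm, mul_div_cancel_left₀ _ two_ne_zero]
    exact hstep k t
  have hlim : ∀ t, ∃ a, Filter.Tendsto (fun k => W k t) Filter.atTop (nhds a) := fun t =>
    cauchySeq_tendsto_of_complete (cauchySeq_of_le_geometric_two (hdist t))
  choose w hw using hlim
  have hdw : ∀ k t, ‖W k t - w t‖ ≤ 2 * D / 2 ^ k := fun k t => by
    rw [← dist_eq_norm]
    exact dist_le_of_le_geometric_two_of_tendsto (hdist t) (hw t) k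
  have hzero : Filter.Tendsto (fun k : ℕ => 2 * D / 2 ^ k) Filter.atTop (nhds 0) :=
    tendsto_const_nhds.div_atTop (tendsto_pow_atTop_atTop_of_one_lt (by norm_num))
  have hwc : Continuous w := by
    have hunif : TendstoUniformly W w Filter.atTop := by
      rw [Metric.tendstoUniformly_iff]
      intro ε hε
      filter_upwards [hzero.eventually (gt_mem_nhds hε)] with k hk t
      rw [dist_comm, dist_eq_norm]
      exact (hdw k t).trans_lt hk
    exact hunif.continuous (Filter.Eventually.of_forall hWc).frequently
  have hwM : ∀ t, ‖w t‖ ≤ M := fun t =>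
    le_of_tendsto (hw t).norm (Filter.Eventually.of_forall fun k => hWM k t)
  have hXwK : ∀ t, X w t ∈ K := fun t => hK _ (norm_frozenPrimitive_sub_le hd hwM t)
  have hmem : ∀ t, w t ∈ F (X w t) := by
    intro t
    have hu : ∀ k, ∃ u ∈ F (X w t), ‖W (k + 1) t - u‖ ≤ L * (2 * D / 2 ^ k * d) := fun k => by
      obtain ⟨u, hu, hle⟩ := hLip _ (hXK k t) _ (hXwK t) (W (k + 1) t) (hPmem _ _)
      refine ⟨u, hu, hle.trans ?_⟩
      gcongr
      rw [norm_sub_rev]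
      exact norm_frozenPrimitive_sub_frozenPrimitive_le hd (hWc k) hwc (hdw k) t
    choose u hu hle using hu
    have h0 : Filter.Tendsto (fun k => W (k + 1) t - u k) Filter.atTop (nhds 0) :=
      squeeze_zero_norm hle (by simpa using (hzero.mul_const d).const_mul L)
    refine (hcl _).mem_of_tendsto (f := u) (b := Filter.atTop) ?_
      (Filter.Eventually.of_forall hu)
    simpa using ((Filter.tendsto_add_atTop_iff_nat 1).2 (hw t)).sub h0
  have hderiv : ∀ t, HasDerivAt (fun t => y + ∫ s in (0 : ℝ)..t, w s) (w t) t := fun t =>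
    (intervalIntegral.integral_hasDerivAt_right (hwc.intervalIntegrable _ _)
      (hwc.stronglyMeasurableAtFilter _ _) hwc.continuousAt).const_add y
  refine ⟨y + ∫ s in (0 : ℝ)..d, w s, ⟨hd, fun t => y + ∫ s in (0 : ℝ)..t, w s, ⟨?_, ?_⟩, ?_, rfl⟩,
    ?_⟩
  · have hlip : LipschitzWith ⟨M, hM0⟩ (fun t => y + ∫ s in (0 : ℝ)..t, w s) :=
      lipschitzWith_of_nnnorm_deriv_le (fun t => (hderiv t).differentiableAt) fun t => by
        rw [(hderiv t).deriv]
        exact hwM t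
    exact hlip.lipschitzOnWith.absolutelyContinuousOnInterval
  · refine Filter.Eventually.of_forall fun t ht => ⟨(hderiv t).differentiableAt, ?_⟩
    rw [(hderiv t).deriv]
    have := hmem t
    rwa [hX, frozenPrimitive, min_eq_left ht.2, max_eq_right ht.1] at this
  · simp
  · have h1 : y + (∫ s in (0 : ℝ)..d, w s) - y - d • v = ∫ s in (0 : ℝ)..d, (w s - v) := by
      rw [intervalIntegral.integral_sub (hwc.intervalIntegrable _ _)
        (intervalIntegrable_const), intervalIntegral.integral_const, sub_zero, add_sub_cancel_left]
    rw [h1]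
    refine (intervalIntegral.norm_integral_le_of_norm_le_const (C := 2 * D) fun s _ => ?_).trans ?_
    · have := hdw 0 s
      rwa [pow_zero, div_one, hW0, norm_sub_rev] at this
    · rw [sub_zero, abs_of_nonneg hd]

/-- From every point `y` near `β`, and for every short time `d`, there is a trajectory whose
displacement is `d • v` up to second order, for a prescribed `v ∈ F β`. -/
theorem IsAdmissible.exists_reach_near_velocity (hF : IsAdmissible F) {β v : EucSpace n}
    (hv : v ∈ F β) : ∃ C δ : ℝ, 0 ≤ C ∧ 0 < δ ∧ ∀ (d : ℝ) (y : EucSpace n), 0 ≤ d → d < δ →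
      ‖y - β‖ < δ → ∃ Y, Reach F d y Y ∧ ‖Y - y - d • v‖ ≤ C * d * (‖y - β‖ + d) := by
  obtain ⟨γ, c, hγ, hc, hgr⟩ := hF.linearGrowth
  obtain ⟨L, hL, hLip⟩ := hF.locallyLipschitz (Metric.closedBall β 2) (isCompact_closedBall _ _)
  set M := γ * (‖β‖ + 2) + c with hMdef
  have hM0 : 0 < M := by positivity
  have hM : ∀ x ∈ Metric.closedBall β 2, ∀ v ∈ F x, ‖v‖ ≤ M := fun x hx v hv => by
    refine (hgr x v hv).trans ?_
    have h1 := norm_le_norm_add_norm_sub' x β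
    have h2 := mem_closedBall_iff_norm.1 hx
    rw [hMdef]
    gcongr
    linarith
  refine ⟨2 * L * (1 + M), min 1 (min (1 / M) (1 / (2 * (L + 1)))), by positivity, by positivity,
    fun d y hd hdδ hy => ?_⟩
  have hMd : M * d ≤ 1 := by
    have : d ≤ 1 / M := hdδ.le.trans ((min_le_right _ _).trans (min_le_left _ _))
    calc M * d ≤ M * (1 / M) := by gcongr
      _ = 1 := by field_simp
  have hLd : L * d ≤ 1 / 2 := by
    have : d ≤ 1 / (2 * (L + 1)) := hdδ.le.trans ((min_le_right _ _).trans (min_le_right _ _))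
    calc L * d ≤ (L + 1) * (1 / (2 * (L + 1))) := by gcongr; linarith
      _ = 1 / 2 := by field_simp
  have hy1 : ‖y - β‖ ≤ 1 := hy.le.trans (min_le_left _ _)
  obtain ⟨Y, hY, hle⟩ := _root_.exists_reach_near_velocity hF.nonempty
    (fun x => (hF.compact x).isClosed) hF.convex hLip hL hM
    (Metric.mem_closedBall_self (by norm_num)) hv hd (y := y) (fun x hx => by
      rw [mem_closedBall_iff_norm]
      have h1 := norm_add_le (x - y) (y - β)
      rw [sub_add_sub_cancel] at h1
      linarith) hLd
  refine ⟨Y, hY, hle.trans ?_⟩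
  have h3 : ‖y - β‖ + M * d ≤ (1 + M) * (‖y - β‖ + d) := by
    nlinarith [norm_nonneg (y - β), mul_nonneg hM0.le (norm_nonneg (y - β))]
  calc 2 * (L * (‖y - β‖ + M * d)) * d ≤ 2 * (L * ((1 + M) * (‖y - β‖ + d))) * d := by gcongr
    _ = _ := by ring

/-- A point `x` near `α` can be approached, from a suitable `z` and in a prescribed short time `d`,
along a trajectory whose displacement in direction `p` is at most `d * h(α, p)`, up to second
order. -/
theorem IsAdmissible.exists_reach_displacement (hF : IsAdmissible F) (α p : EucSpace n) :
    ∃ C δ : ℝ, 0 ≤ C ∧ 0 < δ ∧ ∀ (d : ℝ) (x : EucSpace n), 0 ≤ d → d < δ → ‖x - α‖ < δ →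
      ∃ z, Reach F d z x ∧ ‖z - x‖ ≤ C * d ∧
        -(d * hamiltonian F α p) - C * d * (‖x - α‖ + d) ≤ ⟪p, z - x⟫ := by
  obtain ⟨v, hv, hvp⟩ := hF.exists_inner_eq_hamiltonian α p
  obtain ⟨C, δ, hC, hδ, H⟩ := hF.neg.exists_reach_near_velocity (β := α) (v := -v)
    (by simpa using hv)
  refine ⟨C * (δ + δ) + ‖v‖ + ‖p‖ * C, δ, by positivity, hδ, fun d x hd hdδ hx => ?_⟩
  obtain ⟨z, hz, hle⟩ := H d x hd hdδ hx
  refine ⟨z, reach_neg_iff.1 hz, ?_, ?_⟩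
  · have h1 := norm_add_le (z - x - d • -v) (d • -v)
    rw [sub_add_cancel, norm_smul, norm_neg, Real.norm_of_nonneg hd] at h1
    have h2 : C * d * (‖x - α‖ + d) ≤ C * d * (δ + δ) := by gcongr
    have h3 : 0 ≤ ‖p‖ * C * d := by positivity
    linarith
  · have h1 : ⟪p, d • -v - (z - x)⟫ ≤ ‖p‖ * (C * d * (‖x - α‖ + d)) := by
      refine (real_inner_le_norm _ _).trans ?_
      rw [norm_sub_rev]
      gcongr
    rw [inner_sub_right, inner_smul_right, inner_neg_right, real_inner_comm, hvp] at h1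
    have h2 : ‖p‖ * (C * d * (‖x - α‖ + d)) ≤
        (C * (δ + δ) + ‖v‖ + ‖p‖ * C) * d * (‖x - α‖ + d) := by
      have : 0 ≤ (C * (δ + δ) + ‖v‖) * d * (‖x - α‖ + d) := by positivity
      linarith
    linarith

end Filippov

/-! ### Fréchet normals in coordinates -/

section ProductNorm

variable {A B : Type*} [NormedAddCommGroup A] [NormedAddCommGroup B]

theorem WithLp.prod_norm_fst_le_of_L2 (p : WithLp 2 (A × B)) : ‖p.fst‖ ≤ ‖p‖ := by
  rw [WithLp.prod_norm_eq_of_L2]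
  exact Real.le_sqrt_of_sq_le (le_add_of_nonneg_right (sq_nonneg _))

theorem WithLp.prod_norm_snd_le_of_L2 (p : WithLp 2 (A × B)) : ‖p.snd‖ ≤ ‖p‖ := by
  rw [WithLp.prod_norm_eq_of_L2]
  exact Real.le_sqrt_of_sq_le (le_add_of_nonneg_left (sq_nonneg _))

theorem WithLp.prod_norm_le_add_of_L2 (p : WithLp 2 (A × B)) : ‖p‖ ≤ ‖p.fst‖ + ‖p.snd‖ := by
  rw [WithLp.prod_norm_eq_of_L2]
  refine Real.sqrt_le_iff.2 ⟨by positivity, ?_⟩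
  nlinarith [norm_nonneg p.fst, norm_nonneg p.snd]

end ProductNorm

section Normals

variable {n : ℕ} {F : EucSpace n → Set (EucSpace n)}

/-- `(ζ, θ)` is a Fréchet normal at `(α, β)` to the level set `{T ≤ r}`, written with the two
coordinates separated. -/
def IsLevelNormal (F : EucSpace n → Set (EucSpace n)) (r : ℝ) (α β ζ θ : EucSpace n) : Prop :=
  ∀ ε : ℝ, 0 < ε → ∃ δ : ℝ, 0 < δ ∧ ∀ x y : EucSpace n, minTime F x y ≤ (r : EReal) →
    ‖x - α‖ < δ → ‖y - β‖ < δ → ⟪ζ, x - α⟫ + ⟪θ, y - β⟫ ≤ ε * (‖x - α‖ + ‖y - β‖)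

/-- `((ζ, θ), l)` is a Fréchet normal at `((α, β), r)` to the epigraph of `T`, written with the
three coordinates separated. -/
def IsEpiNormal (F : EucSpace n → Set (EucSpace n)) (r : ℝ) (α β ζ θ : EucSpace n) (l : ℝ) :
    Prop :=
  ∀ ε : ℝ, 0 < ε → ∃ δ : ℝ, 0 < δ ∧ ∀ (x y : EucSpace n) (s : ℝ), minTime F x y ≤ (s : EReal) →
    ‖x - α‖ < δ → ‖y - β‖ < δ → |s - r| < δ →
      ⟪ζ, x - α⟫ + ⟪θ, y - β⟫ + l * (s - r) ≤ ε * (‖x - α‖ + ‖y - β‖ + |s - r|)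

variable {r l : ℝ} {α β ζ θ : EucSpace n}

theorem mem_frechetNormalCone_reachableSetAt_iff :
    mkPair ζ θ ∈ frechetNormalCone (reachableSetAt F r) (mkPair α β) ↔
      IsLevelNormal F r α β ζ θ := by
  constructor
  · intro h ε hε
    obtain ⟨δ, hδ, H⟩ := h ε hε
    refine ⟨δ / 2, by positivity, fun x y hT hx hy => ?_⟩
    have hle : ‖mkPair x y - mkPair α β‖ ≤ ‖x - α‖ + ‖y - β‖ :=
      WithLp.prod_norm_le_add_of_L2 (mkPair x y - mkPair α β)
    have h1 := H (mkPair x y) hT (by linarith)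
    rw [WithLp.prod_inner_apply] at h1
    exact h1.trans (by gcongr)
  · intro h ε hε
    obtain ⟨δ, hδ, H⟩ := h (ε / 2) (by positivity)
    refine ⟨δ, hδ, fun q hq hlt => ?_⟩
    have h1 : ‖q.fst - α‖ ≤ ‖q - mkPair α β‖ := WithLp.prod_norm_fst_le_of_L2 (q - mkPair α β)
    have h2 : ‖q.snd - β‖ ≤ ‖q - mkPair α β‖ := WithLp.prod_norm_snd_le_of_L2 (q - mkPair α β)
    have h3 := H q.fst q.snd hq (h1.trans_lt hlt) (h2.trans_lt hlt)
    rw [WithLp.prod_inner_apply]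
    refine h3.trans ?_
    nlinarith

theorem mem_frechetNormalCone_epigraph_iff :
    mkEpi (mkPair ζ θ) l ∈ frechetNormalCone (epigraph (minTimeFun F)) (mkEpi (mkPair α β) r) ↔
      IsEpiNormal F r α β ζ θ l := by
  have hinner : ∀ q : EpiSpace n, ⟪mkEpi (mkPair ζ θ) l, q - mkEpi (mkPair α β) r⟫ =
      ⟪ζ, q.fst.fst - α⟫ + ⟪θ, q.fst.snd - β⟫ + l * (q.snd - r) := fun q => by
    rw [WithLp.prod_inner_apply]
    have h1 : ⟪mkPair ζ θ, q.fst - mkPair α β⟫ = ⟪ζ, q.fst.fst - α⟫ + ⟪θ, q.fst.snd - β⟫ :=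
      WithLp.prod_inner_apply _ _
    have h2 : ⟪l, q.snd - r⟫ = l * (q.snd - r) := by
      rw [real_inner_comm]; rfl
    rw [← h1, ← h2]
    rfl
  constructor
  · intro h ε hε
    obtain ⟨δ, hδ, H⟩ := h ε hε
    refine ⟨δ / 3, by positivity, fun x y s hT hx hy hs => ?_⟩
    have hle₁ : ‖mkPair x y - mkPair α β‖ ≤ ‖x - α‖ + ‖y - β‖ :=
      WithLp.prod_norm_le_add_of_L2 (mkPair x y - mkPair α β)
    have hle₂ : ‖mkEpi (mkPair x y) s - mkEpi (mkPair α β) r‖ ≤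
        ‖mkPair x y - mkPair α β‖ + |s - r| :=
      WithLp.prod_norm_le_add_of_L2 (mkEpi (mkPair x y) s - mkEpi (mkPair α β) r)
    have h1 := H (mkEpi (mkPair x y) s) hT (by linarith)
    rw [hinner] at h1
    refine h1.trans ?_
    gcongr
    linarith
  · intro h ε hε
    obtain ⟨δ, hδ, H⟩ := h (ε / 3) (by positivity)
    refine ⟨δ, hδ, fun q hq hlt => ?_⟩
    have h0 : ‖q.fst - mkPair α β‖ ≤ ‖q - mkEpi (mkPair α β) r‖ :=
      WithLp.prod_norm_fst_le_of_L2 (q - mkEpi (mkPair α β) r)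
    have h1 : ‖q.fst.fst - α‖ ≤ ‖q.fst - mkPair α β‖ :=
      WithLp.prod_norm_fst_le_of_L2 (q.fst - mkPair α β)
    have h2 : ‖q.fst.snd - β‖ ≤ ‖q.fst - mkPair α β‖ :=
      WithLp.prod_norm_snd_le_of_L2 (q.fst - mkPair α β)
    have h3 : |q.snd - r| ≤ ‖q - mkEpi (mkPair α β) r‖ :=
      WithLp.prod_norm_snd_le_of_L2 (q - mkEpi (mkPair α β) r)
    have h4 := H q.fst.fst q.fst.snd q.snd hq (by linarith) (by linarith) (by linarith)
    rw [hinner]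
    refine h4.trans ?_
    nlinarith

theorem IsLevelNormal.neg (h : IsLevelNormal F r α β ζ θ) :
    IsLevelNormal (fun x => -F x) r β α θ ζ := by
  intro ε hε
  obtain ⟨δ, hδ, H⟩ := h ε hε
  refine ⟨δ, hδ, fun x y hT hx hy => ?_⟩
  rw [minTime_neg] at hT
  linarith [H y x hT hy hx]

theorem IsEpiNormal.neg (h : IsEpiNormal F r α β ζ θ l) :
    IsEpiNormal (fun x => -F x) r β α θ ζ l := by
  intro ε hε
  obtain ⟨δ, hδ, H⟩ := h ε hε
  refine ⟨δ, hδ, fun x y s hT hx hy hs => ?_⟩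
  rw [minTime_neg] at hT
  linarith [H y x s hT hy hx hs]

theorem IsEpiNormal.isLevelNormal (h : IsEpiNormal F r α β ζ θ l) :
    IsLevelNormal F r α β ζ θ := by
  intro ε hε
  obtain ⟨δ, hδ, H⟩ := h ε hε
  refine ⟨δ, hδ, fun x y hT hx hy => ?_⟩
  simpa using H x y r hT hx hy (by simpa using hδ)

/-- First-order comparison: an inequality `d * a ≤ o(d)`, in the quantitative form produced by
Fréchet normals, forces `a ≤ 0`. -/
theorem nonpos_of_forall_mul_le {a K : ℝ} (hK : 0 ≤ K)
    (h : ∀ ε : ℝ, 0 < ε → ∃ δ : ℝ, 0 < δ ∧ ∀ d : ℝ, 0 < d → d < δ → d * a ≤ d * (K * (ε + d))) :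
    a ≤ 0 := by
  by_contra! ha
  obtain ⟨δ, hδ, H⟩ := h (a / (4 * (K + 1))) (by positivity)
  have hd : 0 < min (δ / 2) (a / (4 * (K + 1))) := by positivity
  have h1 := le_of_mul_le_mul_left
    (H _ hd ((min_le_left _ _).trans_lt (by linarith))) hd
  have h2 : K * (a / (4 * (K + 1)) + min (δ / 2) (a / (4 * (K + 1)))) ≤
      (K + 1) * (a / (4 * (K + 1)) + a / (4 * (K + 1))) := by
    gcongr
    · linarith
    · exact min_le_right _ _
  have h3 : (K + 1) * (a / (4 * (K + 1)) + a / (4 * (K + 1))) = a / 2 := by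
    field_simp
    ring
  linarith

/-! ### Comparison of Hamiltonians -/

theorem IsEpiNormal.nonpos (hT : minTime F α β = (r : EReal)) (h : IsEpiNormal F r α β ζ θ l) :
    l ≤ 0 := by
  refine nonpos_of_forall_mul_le (K := 1) zero_le_one fun ε hε => ?_
  obtain ⟨δ, hδ, H⟩ := h ε hε
  refine ⟨δ, hδ, fun d hd hdδ => ?_⟩
  have hle : minTime F α β ≤ ((r + d : ℝ) : EReal) := by
    rw [hT]
    exact EReal.coe_le_coe_iff.2 (by linarith)
  have := H α β (r + d) hle (by simpa using hδ) (by simpa using hδ)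
    (by rwa [add_sub_cancel_left, abs_of_pos hd])
  simp only [sub_self, inner_zero_right, norm_zero, add_sub_cancel_left, abs_of_pos hd,
    zero_add] at this
  nlinarith

/-- Following a nearly optimal trajectory from `α` to `β` for a short time `d` saves the time `d`,
up to second order. -/
theorem IsAdmissible.exists_drop_start (hF : IsAdmissible F) (hT : minTime F α β = (r : EReal))
    (hr : 0 < r) : ∃ C δ : ℝ, 0 ≤ C ∧ 0 < δ ∧ ∀ d : ℝ, 0 < d → d < δ → ∃ z,
      minTime F z β ≤ ((r + d ^ 2 - d : ℝ) : EReal) ∧ ‖z - α‖ ≤ C * d ∧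
        ∀ p, d * hamiltonian F α p - C * ‖p‖ * d * d ≤ ⟪p, z - α⟫ := by
  obtain ⟨C, δ, hC, hδ, H⟩ := hF.exists_displacement_bound α
  refine ⟨C, min δ r, hC, by positivity, fun d hd hdδ => ?_⟩
  obtain ⟨τ, hτ, hR⟩ := minTime_le_coe_iff.1 hT.le (d ^ 2) (by positivity)
  have hrτ : r ≤ τ := EReal.coe_le_coe_iff.1 (hT ▸ hR.minTime_le)
  obtain ⟨z, hz, hz'⟩ := hR.split hd.le ((hdδ.le.trans (min_le_right _ _)).trans hrτ)
  obtain ⟨h1, h2⟩ := H d α z hz (hdδ.trans_le (min_le_left _ _)) (by simpa using hδ)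
  refine ⟨z, hz'.minTime_le.trans (EReal.coe_le_coe_iff.2 (by linarith)), h1, fun p => ?_⟩
  simpa using h2 p

theorem IsEpiNormal.hamiltonian_le (hF : IsAdmissible F) (hT : minTime F α β = (r : EReal))
    (hr : 0 < r) (h : IsEpiNormal F r α β ζ θ l) : hamiltonian F α ζ ≤ l := by
  obtain ⟨C, δ₁, hC, hδ₁, H₁⟩ := hF.exists_drop_start hT hr
  refine sub_nonpos.1 (nonpos_of_forall_mul_le (K := C + 1 + C * ‖ζ‖ + |l|) (by positivity)
    fun ε hε => ?_)
  obtain ⟨δ, hδ, H⟩ := h ε hε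
  refine ⟨min δ₁ (min 1 (δ / (C + 1))), by positivity, fun d hd hdδ => ?_⟩
  have hd1 : d < 1 := hdδ.trans_le ((min_le_right _ _).trans (min_le_left _ _))
  have hdC : (C + 1) * d < δ := by
    have : d < δ / (C + 1) := hdδ.trans_le ((min_le_right _ _).trans (min_le_right _ _))
    rwa [lt_div_iff₀' (by positivity)] at this
  obtain ⟨z, hz, hzn, hzp⟩ := H₁ d hd (hdδ.trans_le (min_le_left _ _))
  have hs : |r + d ^ 2 - d - r| ≤ d := by
    rw [abs_le]
    constructor <;> nlinarith
  have hCd : 0 ≤ C * d := by positivity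
  have h1 := H z β _ hz (by linarith) (by simpa using hδ) (by linarith)
  simp only [sub_self, inner_zero_right, norm_zero, add_zero] at h1
  have h2 : ε * (‖z - α‖ + |r + d ^ 2 - d - r|) ≤ ε * (C * d + d) := by gcongr
  have h3 := hzp ζ
  have h4 : 0 ≤ (|l| + l) * d ^ 2 := mul_nonneg (by linarith [neg_abs_le l]) (sq_nonneg d)
  have h5 : 0 ≤ (C * ‖ζ‖ + |l|) * ε * d + (C + 1) * d ^ 2 := by positivity
  linarith

theorem IsEpiNormal.le_hamiltonian (hF : IsAdmissible F) (hT : minTime F α β = (r : EReal))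
    (h : IsEpiNormal F r α β ζ θ l) : l ≤ hamiltonian F α ζ := by
  obtain ⟨C, δ₁, hC, hδ₁, H₁⟩ := hF.exists_reach_displacement α ζ
  refine sub_nonpos.1 (nonpos_of_forall_mul_le (K := C + 1) (by positivity) fun ε hε => ?_)
  obtain ⟨δ, hδ, H⟩ := h ε hε
  refine ⟨min δ₁ (δ / (C + 1)), by positivity, fun d hd hdδ => ?_⟩
  have hdC : (C + 1) * d < δ := by
    have : d < δ / (C + 1) := hdδ.trans_le (min_le_right _ _)
    rwa [lt_div_iff₀' (by positivity)] at this
  obtain ⟨z, hz, hzn, hzp⟩ := H₁ d α hd.le (hdδ.trans_le (min_le_left _ _)) (by simpa using hδ₁)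
  have hCd : 0 ≤ C * d := by positivity
  have h1 := H z β (d + r) (minTime_le_add hz.minTime_le hT.le) (by linarith) (by simpa using hδ)
    (by rw [add_sub_cancel_right, abs_of_pos hd]; linarith)
  simp only [sub_self, inner_zero_right, norm_zero, add_zero, add_sub_cancel_right,
    abs_of_pos hd] at h1
  simp only [sub_self, norm_zero, zero_add] at hzp
  have h2 : ε * (‖z - α‖ + d) ≤ ε * (C * d + d) := by gcongr
  have h3 : 0 ≤ d * d := by positivity
  linarith

theorem IsLevelNormal.hamiltonian_nonpos (hF : IsAdmissible F)
    (hT : minTime F α β = (r : EReal)) (hr : 0 < r) (h : IsLevelNormal F r α β ζ θ) :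
    hamiltonian F α ζ ≤ 0 := by
  obtain ⟨C, δ₁, hC, hδ₁, H₁⟩ := hF.exists_drop_start hT hr
  refine nonpos_of_forall_mul_le (K := C + C * ‖ζ‖) (by positivity) fun ε hε => ?_
  obtain ⟨δ, hδ, H⟩ := h ε hε
  refine ⟨min δ₁ (min 1 (δ / (C + 1))), by positivity, fun d hd hdδ => ?_⟩
  have hd1 : d < 1 := hdδ.trans_le ((min_le_right _ _).trans (min_le_left _ _))
  have hdC : (C + 1) * d < δ := by
    have : d < δ / (C + 1) := hdδ.trans_le ((min_le_right _ _).trans (min_le_right _ _))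
    rwa [lt_div_iff₀' (by positivity)] at this
  obtain ⟨z, hz, hzn, hzp⟩ := H₁ d hd (hdδ.trans_le (min_le_left _ _))
  have h1 := H z β (hz.trans (EReal.coe_le_coe_iff.2 (by nlinarith))) (by linarith)
    (by simpa using hδ)
  simp only [sub_self, inner_zero_right, norm_zero, add_zero] at h1
  have h2 : ε * ‖z - α‖ ≤ ε * (C * d) := by gcongr
  have h3 := hzp ζ
  have h4 : 0 ≤ C * ‖ζ‖ * ε * d + C * d ^ 2 := by positivity
  linarith

/-- Cutting off the beginning of a trajectory and prolonging its end by the same amount of time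
stays in the level set. -/
theorem IsLevelNormal.hamiltonian_le (hF : IsAdmissible F) (hT : minTime F α β = (r : EReal))
    (hr : 0 < r) (h : IsLevelNormal F r α β ζ θ) :
    hamiltonian F α ζ ≤ hamiltonian F β (-θ) := by
  obtain ⟨C, δ₁, hC, hδ₁, H₁⟩ := hF.exists_drop_start hT hr
  obtain ⟨C', δ₂, hC', hδ₂, H₂⟩ := hF.neg.exists_reach_displacement β θ
  rw [hamiltonian_neg] at H₂
  set b := hamiltonian F β (-θ)
  refine sub_nonpos.1 (nonpos_of_forall_mul_le (K := C + C' + C * ‖ζ‖ + |b|)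
    (by positivity) fun ε hε => ?_)
  obtain ⟨δ, hδ, H⟩ := h ε hε
  refine ⟨min δ₁ (min 1 (min δ₂ (δ / (C + C' + 1)))), by positivity, fun d hd hdδ => ?_⟩
  obtain ⟨hdδ₁, hd1, hdδ₂, hdC⟩ : d < δ₁ ∧ d < 1 ∧ d < δ₂ ∧ d < δ / (C + C' + 1) := by
    simpa only [lt_min_iff] using hdδ
  rw [lt_div_iff₀' (by positivity)] at hdC
  have hCd : 0 ≤ C * d := by positivity
  have hCd' : 0 ≤ C' * d := by positivity
  -- The end is prolonged by `d - d ^ 2`, which absorbs the defect of optimality `d ^ 2`.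
  set e := d - d ^ 2 with he
  have he0 : 0 ≤ e := by nlinarith
  have hed : e ≤ d := by nlinarith
  obtain ⟨z, hz, hzn, hzp⟩ := H₁ d hd hdδ₁
  obtain ⟨Y, hY, hYn, hYp⟩ := H₂ e β he0 (hed.trans_lt hdδ₂) (by simpa using hδ₂)
  have hsum : minTime F z Y ≤ (r : EReal) := by
    have := minTime_le_add hz (reach_neg_iff.1 hY).minTime_le
    rwa [he, show r + d ^ 2 - d + (d - d ^ 2) = r by ring] at this
  have hCe : C' * e ≤ C' * d := by gcongr
  have h1 := H z Y hsum (by linarith) (by linarith)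
  have h2 : ε * (‖z - α‖ + ‖Y - β‖) ≤ ε * (C * d + C' * d) := by
    gcongr
    exact hYn.trans hCe
  have h3 := hzp ζ
  simp only [sub_self, norm_zero, zero_add] at hYp
  have h4 : C' * e * e ≤ C' * d * d := by gcongr
  have h5 : 0 ≤ (|b| + b) * d ^ 2 := mul_nonneg (by linarith [neg_abs_le b]) (sq_nonneg d)
  have h6 : 0 ≤ (C * ‖ζ‖ + |b|) * ε * d + C * d ^ 2 := by positivity
  have h7 : e * b = d * b - d ^ 2 * b := by rw [he]; ring
  linarith

theorem IsLevelNormal.hamiltonian_eq (hF : IsAdmissible F) (hT : minTime F α β = (r : EReal))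
    (hr : 0 < r) (h : IsLevelNormal F r α β ζ θ) :
    hamiltonian F α ζ = hamiltonian F β (-θ) := by
  refine le_antisymm (h.hamiltonian_le hF hT hr) ?_
  have := h.neg.hamiltonian_le hF.neg (minTime_neg.trans hT) hr
  rwa [hamiltonian_neg, hamiltonian_neg, neg_neg] at this

/-! ### From level sets to the epigraph -/

/-- Points of the epigraph are moved to the level set by changing the first coordinate only: if
`T(x, y) ≤ s` with `s > r`, the trajectory is shortened at its beginning, and if `s < r`, it is
prolonged there. -/
theorem IsLevelNormal.isEpiNormal (hF : IsAdmissible F) (hT : minTime F α β = (r : EReal))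
    (hr : 0 < r) (h : IsLevelNormal F r α β ζ θ) :
    IsEpiNormal F r α β ζ θ (hamiltonian F α ζ) := by
  have hl := h.hamiltonian_nonpos hF hT hr
  obtain ⟨C₁, δ₁, hC₁, hδ₁, H₁⟩ := hF.exists_displacement_bound α
  obtain ⟨C₂, δ₂, hC₂, hδ₂, H₂⟩ := hF.exists_reach_displacement α ζ
  set l := hamiltonian F α ζ
  intro ε hε
  set Q := 1 + 2 * C₁ + C₂ with hQ
  set N := 6 * C₁ * ‖ζ‖ + |l| + 2 * C₂ + 1 with hN
  have hQ0 : 0 < Q := by positivity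
  have hN0 : 0 < N := by positivity
  obtain ⟨δ₃, hδ₃, H⟩ := h (ε / (2 * Q)) (by positivity)
  have hεQ : ε / (2 * Q) * Q = ε / 2 := by field_simp
  set ε₁ := ε / (2 * Q)
  have hε₁ : 0 < ε₁ := by positivity
  refine ⟨min 1 (min (δ₁ / 2) (min δ₂ (min (δ₃ / Q) (min r (ε / (2 * N)))))), by positivity,
    fun x y s hs hx hy hsr => ?_⟩
  generalize hδ : min 1 (min (δ₁ / 2) (min δ₂ (min (δ₃ / Q) (min r (ε / (2 * N)))))) = δ
    at hx hy hsr
  obtain ⟨hδa, hδb, hδc, hδd, hδr, hδe⟩ : δ ≤ 1 ∧ δ ≤ δ₁ / 2 ∧ δ ≤ δ₂ ∧ δ ≤ δ₃ / Q ∧ δ ≤ r ∧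
      δ ≤ ε / (2 * N) := by
    simpa only [le_min_iff] using hδ.ge
  rw [le_div_iff₀' hQ0] at hδd
  rw [le_div_iff₀' (by positivity)] at hδe
  have hx0 := norm_nonneg (x - α)
  have hy0 := norm_nonneg (y - β)
  have hδ0 : 0 < δ := hx0.trans_lt hx
  have hC₁δ : 0 ≤ C₁ * δ := by positivity
  have hC₂δ : 0 ≤ C₂ * δ := by positivity
  have hyδ₃ : ‖y - β‖ < δ₃ := by rw [hQ] at hδd; linarith
  have hsplit : ∀ z : EucSpace n, ⟪ζ, z - α⟫ = ⟪ζ, z - x⟫ + ⟪ζ, x - α⟫ := fun z => by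
    rw [← inner_add_right, sub_add_sub_cancel]
  have htri : ∀ z : EucSpace n, ‖z - α‖ ≤ ‖z - x‖ + ‖x - α‖ := fun z => by
    simpa using norm_add_le (z - x) (x - α)
  rcases le_or_gt (minTime F x y) (r : EReal) with hxy | hxy
  · rcases le_or_gt r s with hrs | hrs
    · have h1 := H x y hxy (by rw [hQ] at hδd; linarith) hyδ₃
      have h2 : l * (s - r) ≤ 0 := mul_nonpos_of_nonpos_of_nonneg hl (by linarith)
      have h3 : ε₁ * (‖x - α‖ + ‖y - β‖) ≤ ε * (‖x - α‖ + ‖y - β‖ + |s - r|) := by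
        have hε₁ε : ε₁ ≤ ε := by
          have : ε₁ * 1 ≤ ε₁ * Q := by gcongr; rw [hQ]; linarith
          linarith
        exact mul_le_mul hε₁ε (le_add_of_nonneg_right (abs_nonneg _)) (by positivity) hε.le
      linarith
    · obtain ⟨t, ht⟩ : ∃ t, t = r - s := ⟨_, rfl⟩
      have ht0 : 0 < t := by linarith
      have habs : |s - r| = t := by rw [abs_of_neg (by linarith)]; linarith
      rw [habs] at hsr ⊢
      obtain ⟨z, hz, hzn, hzp⟩ := H₂ t x ht0.le (hsr.trans_le hδc) (hx.trans_le hδc)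
      have hzy : minTime F z y ≤ (r : EReal) := by
        have := minTime_le_add hz.minTime_le hs
        rwa [ht, sub_add_cancel] at this
      have h0 : C₂ * t ≤ C₂ * δ := by gcongr
      have h1 := H z y hzy (by have := htri z; rw [hQ] at hδd; linarith) hyδ₃
      rw [hsplit] at h1
      have h2 : ε₁ * (‖z - α‖ + ‖y - β‖) ≤ ε₁ * (Q * (‖x - α‖ + ‖y - β‖ + t)) := by
        gcongr
        have := htri z
        have : 0 ≤ (2 * C₁ + C₂) * (‖x - α‖ + ‖y - β‖) + (1 + 2 * C₁) * t := by positivity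
        rw [hQ]
        linarith
      rw [← mul_assoc, hεQ] at h2
      have h3 : C₂ * t * (‖x - α‖ + t) ≤ C₂ * t * (δ + δ) := by gcongr
      have h4 : C₂ * t * (δ + δ) ≤ ε / 2 * t := by
        have : 0 ≤ (6 * C₁ * ‖ζ‖ + |l| + 1) * δ * t := by positivity
        have h6 : 2 * N * δ * t ≤ ε * t := by gcongr
        rw [hN] at h6
        linarith
      have h5 : l * (s - r) = -(t * l) := by rw [ht]; ring
      have h6 : 0 ≤ ε * (‖x - α‖ + ‖y - β‖) := by positivity
      linarith
  · have hrs : r < s := EReal.coe_lt_coe_iff.1 (hxy.trans_le hs)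
    obtain ⟨t, ht⟩ : ∃ t, t = s - r := ⟨_, rfl⟩
    have ht0 : 0 < t := by linarith
    have habs : |s - r| = t := by rw [abs_of_pos (by linarith)]; linarith
    rw [habs] at hsr ⊢
    obtain ⟨τ, hτ, hR⟩ := minTime_le_coe_iff.1 hs (t ^ 2) (by positivity)
    have hrτ : r < τ := EReal.coe_lt_coe_iff.1 (hxy.trans_le hR.minTime_le)
    obtain ⟨d, hd⟩ : ∃ d, d = τ - r := ⟨_, rfl⟩
    have hd0 : 0 < d := by linarith
    have hdt : d ≤ t + t ^ 2 := by linarith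
    have hd2 : d ≤ 2 * t := by nlinarith
    obtain ⟨z, hz, hz'⟩ := hR.split hd0.le (by linarith)
    have hzy : minTime F z y ≤ (r : EReal) := by
      have := hz'.minTime_le
      rwa [hd, sub_sub_cancel] at this
    obtain ⟨hzn, hzp⟩ := H₁ d x z hz (by linarith) (by linarith)
    have hzn' : C₁ * d ≤ C₁ * (2 * t) := by gcongr
    have h0 : C₁ * (2 * t) ≤ C₁ * (2 * δ) := by gcongr
    have h1 := H z y hzy (by have := htri z; rw [hQ] at hδd; linarith) hyδ₃
    rw [hsplit] at h1
    have h2 : ε₁ * (‖z - α‖ + ‖y - β‖) ≤ ε₁ * (Q * (‖x - α‖ + ‖y - β‖ + t)) := by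
      gcongr
      have := htri z
      have : 0 ≤ (2 * C₁ + C₂) * (‖x - α‖ + ‖y - β‖) + (1 + C₂) * t := by positivity
      rw [hQ]
      linarith
    rw [← mul_assoc, hεQ] at h2
    have h3 : C₁ * ‖ζ‖ * d * (‖x - α‖ + d) ≤ C₁ * ‖ζ‖ * (2 * t) * (δ + 2 * δ) := by
      gcongr
      linarith
    have h4 := hzp ζ
    -- The sign of `l` turns the upper bound on the time saved into a lower bound on `d * l`.
    have h5 : (t + t ^ 2) * l ≤ d * l := mul_le_mul_of_nonpos_right hdt hl
    have h6 : -(t ^ 2 * l) ≤ |l| * δ * t := by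
      have : |l| * t * t ≤ |l| * δ * t := by gcongr
      rw [abs_of_nonpos hl] at this ⊢
      linarith
    have h7 : C₁ * ‖ζ‖ * (2 * t) * (δ + 2 * δ) + |l| * δ * t ≤ ε / 2 * t := by
      have : 0 ≤ (2 * C₂ + 1) * δ * t := by positivity
      have h8 : 2 * N * δ * t ≤ ε * t := by gcongr
      rw [hN] at h8
      linarith
    have h8 : l * (s - r) = t * l := by rw [ht]; ring
    have h9 : 0 ≤ ε * (‖x - α‖ + ‖y - β‖) := by positivity
    linarith

end Normals

theorem theorem3p5 {n : ℕ} (F : EucSpace n → Set (EucSpace n)) (hF : IsAdmissible F)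
    (α β : EucSpace n) (r : ℝ) (hαβ : mkPair α β ∈ reachableSet F)
    (hr : minTime F α β = (r : EReal)) (hpos : 0 < r) :
    (∀ ζ θ : EucSpace n,
      mkPair ζ θ ∈ frechetNormalCone (reachableSetAt F r) (mkPair α β) →
        hamiltonian F α ζ = hamiltonian F β (-θ) ∧
        mkEpi (mkPair ζ θ) (hamiltonian F α ζ) ∈
          frechetNormalCone (epigraph (minTimeFun F)) (mkEpi (mkPair α β) r)) ∧
    (∀ (ζ θ : EucSpace n) (l : ℝ),
      mkEpi (mkPair ζ θ) l ∈
          frechetNormalCone (epigraph (minTimeFun F)) (mkEpi (mkPair α β) r) →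
        l ≤ 0 ∧ hamiltonian F α ζ = l ∧ hamiltonian F β (-θ) = l ∧
        mkPair ζ θ ∈ frechetNormalCone (reachableSetAt F r) (mkPair α β)) ∧
    (∀ ζ θ : EucSpace n,
      mkPair ζ θ ∈ frechetNormalCone (reachableSetAt F r) (mkPair α β) ↔
        hamiltonian F α ζ = hamiltonian F β (-θ) ∧
        mkEpi (mkPair ζ θ) (hamiltonian F α ζ) ∈
          frechetNormalCone (epigraph (minTimeFun F)) (mkEpi (mkPair α β) r)) := by
  simp only [mem_frechetNormalCone_reachableSetAt_iff, mem_frechetNormalCone_epigraph_iff]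
  have hi : ∀ ζ θ : EucSpace n, IsLevelNormal F r α β ζ θ →
      hamiltonian F α ζ = hamiltonian F β (-θ) ∧
        IsEpiNormal F r α β ζ θ (hamiltonian F α ζ) := fun ζ θ h =>
    ⟨h.hamiltonian_eq hF hr hpos, h.isEpiNormal hF hr hpos⟩
  refine ⟨hi, fun ζ θ l h => ?_, fun ζ θ => ⟨hi ζ θ, fun h => h.2.isLevelNormal⟩⟩
  have hα : hamiltonian F α ζ = l :=
    le_antisymm (h.hamiltonian_le hF hr hpos) (h.le_hamiltonian hF hr)
  exact ⟨h.nonpos hr, hα, (h.isLevelNormal.hamiltonian_eq hF hr hpos).symm.trans hα,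
    h.isLevelNormal⟩
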